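/- Let $a_1,\dots,a_r$ ($r\ge 1$) be positive integers and let $D\geq 1$ be a common multiple of $a_1,\dots,a_r$. The rational function $1/((1-z^{a_1})\cdots(1-z^{a_r}))$ has a partial fraction decomposition $$\frac{1}{(1-z^{a_1})\cdots(1-z^{a_r})}=\sum_{\lambda}\sum_{\ell=1}^{m(\lambda)}\frac{c_{\lambda,\ell}}{(\lambda-z)^{\ell}},$$ where $\lambda$ runs over the complex numbers with $\lambda^{a_i}=1$ for some $i$, and $m(\lambda)$ is the multiplicity of $\lambda$ as a root of $(1-z^{a_1})\cdots(1-z^{a_r})$. For $j\ge 1$ put $\rho_j=e^{2\pi i/j}$ and $m(j)=\#\{i: j\mid a_i\}$. Then for all $j\ge1$ and $1\le m\le m(j)$, $$c_{\rho_j,m}=\frac{\rho_j^m (m-1)!}{D}\sum_{t=m}^{m(j)}(-1)^{t-m}S(t,m)\,\frac{1}{(r-1)!}\sum_{\ell=1}^{j}\rho_j^{\ell}\sum_{k=t-1}^{r-1}s(r,k+1)(-1)^{k-t+1}\binom{k}{t-1}\sum_{\substack{0\le j_i\le D/a_i-1\ (1\le i\le r)\\ a_1j_1+\cdots+a_rj_r\equiv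 \ell\ (\mathrm{mod}\ j)}}D^{-k}(a_1j_1+\cdots+a_rj_r)^{k-t+1}.$$ Here $S(t,m)$ are the Stirling numbers of the second kind, $s(r,k+1)$ are the unsigned Stirling numbers of the first kind, so that $(x+1)(x+2)\cdots(x+r-1)=\sum_{k=0}^{r-1}s(r,k+1)x^k$, and $0^0=1$. -/

import Mathlib

open Finset

/-- The polynomial `(1 - X^{a_1}) ⋯ (1 - X^{a_r})`. -/
noncomputable def denomPoly {r : ℕ} (a : Fin r → ℕ) : Polynomial ℂ :=
  ∏ i, (1 - Polynomial.X ^ a i)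

open Classical in
/-- The finite set of all `lam : ℂ` such that `lam ^ a_i = 1` for some `i` (all `a_i` positive). -/
noncomputable def poleSet {r : ℕ} (a : Fin r → ℕ) : Finset ℂ :=
  univ.biUnion fun i => Polynomial.nthRootsFinset (a i) (1 : ℂ)

/-- `c lam l` are coefficients of a partial fraction decomposition
`1 / ((1 - z^{a_1}) ⋯ (1 - z^{a_r})) = ∑_lam ∑_{l=1}^{m(lam)} c lam l / (lam - z)^l`,
where `lam` runs over the poles and `m(lam)` is the multiplicity of `lam` as a root of the
denominator; the identity is required at every `z` that is not a pole. -/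
def IsPartialFractionDecomposition {r : ℕ} (a : Fin r → ℕ) (c : ℂ → ℕ → ℂ) : Prop :=
  ∀ z : ℂ, ∏ i, (1 - z ^ a i) ≠ 0 →
    1 / ∏ i, (1 - z ^ a i) =
      ∑ lam ∈ poleSet a, ∑ l ∈ Icc 1 ((denomPoly a).rootMultiplicity lam),
        c lam l / (lam - z) ^ l

/-- `ρ_j = exp (2 π i / j)`. -/
noncomputable def rootOfUnity (j : ℕ) : ℂ :=
  Complex.exp (2 * Real.pi * Complex.I / j)

/-- `m(j) = #{i : j ∣ a_i}`. -/
def multCount {r : ℕ} (a : Fin r → ℕ) (j : ℕ) : ℕ :=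
  #{i | j ∣ a i}

/-- The tuples `(j_1, …, j_r)` with `0 ≤ j_i ≤ D / a_i - 1` and
`a_1 j_1 + ⋯ + a_r j_r ≡ l (mod j)`. -/
def boxTuples {r : ℕ} (a : Fin r → ℕ) (D j l : ℕ) : Finset (Fin r → ℕ) :=
  {J ∈ Fintype.piFinset fun i => range (D / a i) | (∑ i, a i * J i) ≡ l [MOD j]}

/-! The Taylor coefficients at `0` are computed in two ways. Partial fractions give `∑ lam⁻¹ ^ n *
R_lam(n)`, where `R_lam` combines the polynomials `choosePoly (l - 1)` with weights `c lam l * lam⁻¹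
^ l`. Writing each `1 / (1 - z ^ a i)` over the common denominator `1 - z ^ D` gives a
quasi-polynomial of period `D`, a sum over the box of tuples. Orthogonality of `D`-th roots of unity
isolates `D * R_mu` (`quasiPolynomial_component`, `partialFraction_component`).

Since `X * choosePoly (l - 1)` is a multiple of the rising factorial of degree `l`, Stirling numbers
of the second kind recover `c mu m` from the coefficients of `R_mu` (`coeff_eq_sum_stirlingSecond`).
Those of the first kind give the coefficients on the box side (`coeff_shiftedChoosePoly`). For `mu =
rootOfUnity j`, tuples are grouped by residue modulo `j`. -/

/-! ### Stirling numbers and the rising factorial basis. -/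

theorem coeff_ascPochhammer_eq_stirlingFirst (n k : ℕ) :
    (ascPochhammer ℂ n).coeff k = (Nat.stirlingFirst n k : ℂ) := by
  induction n generalizing k with
  | zero => cases k <;> simp [Polynomial.coeff_one]
  | succ n ih =>
    rw [ascPochhammer_succ_right, mul_add, Polynomial.coeff_add, ← Polynomial.C_eq_natCast,
      Polynomial.coeff_mul_C]
    cases k with
    | zero => cases n <;> simp [ih]
    | succ k =>
      rw [Polynomial.coeff_mul_X, ih, ih, Nat.stirlingFirst_succ_succ]
      push_cast; ring

theorem X_pow_eq_sum_stirlingSecond_mul_ascPochhammer (t : ℕ) :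
    (Polynomial.X : Polynomial ℂ) ^ t = ∑ m ∈ range (t + 1),
      Polynomial.C ((-1 : ℂ) ^ (t - m) * (Nat.stirlingSecond t m : ℂ)) * ascPochhammer ℂ m := by
  induction t with
  | zero => simp
  | succ t ih =>
    have hX (m : ℕ) : ascPochhammer ℂ m * Polynomial.X =
        ascPochhammer ℂ (m + 1) - Polynomial.C (m : ℂ) * ascPochhammer ℂ m := by
      rw [ascPochhammer_succ_right, Polynomial.C_eq_natCast]; ring
    rw [pow_succ, ih, sum_mul, sum_range_succ' _ (t + 1)]
    simp only [mul_assoc, hX, mul_sub, sum_sub_distrib, Nat.stirlingSecond_succ_zero]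
    rw [sum_range_succ' (fun m => Polynomial.C ((-1 : ℂ) ^ (t - m) * (Nat.stirlingSecond t m : ℂ)) *
      (Polynomial.C (m : ℂ) * ascPochhammer ℂ m)) t]
    -- The added term vanishes because `t < t + 1`; both sums then have the same range and combine
    -- by the Stirling recurrence.
    have hlast : ∑ m ∈ range t, Polynomial.C ((-1 : ℂ) ^ (t - (m + 1)) *
          (Nat.stirlingSecond t (m + 1) : ℂ)) *
          (Polynomial.C ((m + 1 : ℕ) : ℂ) * ascPochhammer ℂ (m + 1)) =
        ∑ m ∈ range (t + 1), Polynomial.C ((-1 : ℂ) ^ (t - (m + 1)) *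
          (Nat.stirlingSecond t (m + 1) : ℂ)) *
          (Polynomial.C ((m + 1 : ℕ) : ℂ) * ascPochhammer ℂ (m + 1)) := by
      rw [sum_range_succ, Nat.stirlingSecond_eq_zero_of_lt (Nat.lt_succ_self t)]; simp
    rw [hlast]
    simp only [Nat.cast_zero, Polynomial.C_0, zero_mul, mul_zero, add_zero]
    rw [← sum_sub_distrib]
    refine sum_congr rfl fun m hm => ?_
    rw [← mul_assoc, ← sub_mul, ← Polynomial.C_mul, ← Polynomial.C_sub,
      Nat.stirlingSecond_succ_succ, Nat.add_sub_add_right]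
    congr 2
    rcases (Nat.lt_succ_iff.mp (mem_range.mp hm)).eq_or_lt with rfl | h
    · rw [Nat.stirlingSecond_eq_zero_of_lt (Nat.lt_succ_self m)]; simp
    · obtain ⟨d, rfl⟩ := Nat.exists_eq_add_of_lt h
      rw [show m + d + 1 - m = d + 1 by omega, show m + d + 1 - (m + 1) = d by omega]
      push_cast; ring

theorem degree_ascPochhammer (n : ℕ) : (ascPochhammer ℂ n).degree = n := by
  rw [Polynomial.degree_eq_natDegree (monic_ascPochhammer ℂ n).ne_zero, ascPochhammer_natDegree]

theorem sum_C_mul_ascPochhammer_injective (N : ℕ) (d e : ℕ → ℂ)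
    (h : ∑ m ∈ range N, Polynomial.C (d m) * ascPochhammer ℂ m =
      ∑ m ∈ range N, Polynomial.C (e m) * ascPochhammer ℂ m) (m : ℕ) (hm : m < N) :
    d m = e m := by
  let S : Polynomial.Sequence ℂ := ⟨fun n => ascPochhammer ℂ n, degree_ascPochhammer⟩
  have hli := linearIndependent_iff'.mp S.linearIndependent (range N) (fun m => d m - e m) (by
    rw [← sub_eq_zero, ← sum_sub_distrib] at h
    rw [← h]
    refine sum_congr rfl fun m _ => ?_
    rw [← sub_mul, ← Polynomial.C_sub, Polynomial.smul_eq_C_mul])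
  exact sub_eq_zero.mp (hli m (mem_range.mpr hm))

/-- Expanding each monomial of `X * p` in rising factorials and comparing coordinates gives the
formula; the factor `X` shifts the coefficient index to `t - 1`. -/
theorem coeff_eq_sum_stirlingSecond {M : ℕ} {d : ℕ → ℂ} {p : Polynomial ℂ}
    (h : Polynomial.X * p = ∑ l ∈ Icc 1 M, Polynomial.C (d l) * ascPochhammer ℂ l)
    {m : ℕ} (hm : 1 ≤ m) (hmM : m ≤ M) :
    d m = ∑ t ∈ Icc m M, (-1 : ℂ) ^ (t - m) * (Nat.stirlingSecond t m : ℂ) * p.coeff (t - 1) := by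
  have hdeg : (Polynomial.X * p).natDegree < M + 1 := by
    rw [h, Nat.lt_succ_iff]
    refine Polynomial.natDegree_sum_le_of_forall_le _ _ fun l hl => ?_
    refine (Polynomial.natDegree_C_mul_le _ _).trans ?_
    rw [ascPochhammer_natDegree]
    exact (mem_Icc.mp hl).2
  have h1 : Polynomial.X * p = ∑ k ∈ range (M + 1), Polynomial.C
      (∑ t ∈ range (M + 1), (-1 : ℂ) ^ (t - k) * (Nat.stirlingSecond t k : ℂ) *
        (Polynomial.X * p).coeff t) * ascPochhammer ℂ k := by
    conv_lhs => rw [Polynomial.as_sum_range_C_mul_X_pow' _ hdeg]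
    simp only [map_sum, sum_mul]
    rw [sum_comm]
    refine sum_congr rfl fun t ht => ?_
    rw [X_pow_eq_sum_stirlingSecond_mul_ascPochhammer, mul_sum]
    rw [← sum_subset (range_subset_range.mpr (mem_range.mp ht : t + 1 ≤ M + 1))]
    · refine sum_congr rfl fun k _ => ?_
      rw [← mul_assoc, ← Polynomial.C_mul, mul_comm (_ : ℂ)]
    · intro k _ hk
      rw [Nat.stirlingSecond_eq_zero_of_lt (by simpa using hk)]
      simp
  have h2 : ∑ l ∈ Icc 1 M, Polynomial.C (d l) * ascPochhammer ℂ l =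
      ∑ l ∈ range (M + 1), Polynomial.C (if l = 0 then 0 else d l) * ascPochhammer ℂ l := by
    have hs : Icc 1 M ⊆ range (M + 1) := fun l hl => by
      rw [mem_Icc] at hl; exact mem_range.mpr (by omega)
    rw [← sum_subset hs]
    · refine sum_congr rfl fun l hl => ?_
      rw [if_neg (by rw [mem_Icc] at hl; omega)]
    · intro l hl hl'
      rw [mem_Icc] at hl'
      rw [mem_range] at hl
      rw [if_pos (by omega)]; simp
  have h3 := sum_C_mul_ascPochhammer_injective (M + 1) _ _ ((h2.symm.trans h.symm).trans h1) m
    (by omega)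
  rw [if_neg (by omega)] at h3
  rw [h3]
  have hs : Icc m M ⊆ range (M + 1) := fun l hl => by
    rw [mem_Icc] at hl; exact mem_range.mpr (by omega)
  rw [← sum_subset hs]
  · refine sum_congr rfl fun t ht => ?_
    obtain ⟨u, rfl⟩ := Nat.exists_eq_add_of_le' (hm.trans (mem_Icc.mp ht).1)
    rw [Polynomial.coeff_X_mul, Nat.add_sub_cancel]
  · intro t ht ht'
    rw [mem_range] at ht
    rw [mem_Icc] at ht'
    rw [Nat.stirlingSecond_eq_zero_of_lt (by omega)]; simp

/-! ### Sums over roots of unity and residue classes. -/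

theorem sum_range_pow_of_pow_eq_one {D : ℕ} {w : ℂ} (hw : w ^ D = 1) :
    ∑ s ∈ range D, w ^ s = if w = 1 then (D : ℂ) else 0 := by
  split_ifs with h
  · simp [h]
  · rw [geom_sum_eq h, hw]; simp

/-- On one residue class modulo `D` the factors `lam⁻¹ ^ n` are constant, so each `P s` is a fixed
combination of the `R lam`; a discrete Fourier sum over `s` inverts this. -/
theorem quasiPolynomial_component {D : ℕ} (hD : 0 < D) {S : Finset ℂ}
    (hS : ∀ lam ∈ S, lam ^ D = 1) {R : ℂ → Polynomial ℂ} {P : ℕ → Polynomial ℂ}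
    (h : ∀ n : ℕ, (P (n % D)).eval (n : ℂ) = ∑ lam ∈ S, lam⁻¹ ^ n * (R lam).eval (n : ℂ))
    {mu : ℂ} (hmu : mu ∈ S) :
    ∑ s ∈ range D, Polynomial.C (mu ^ s) * P s = Polynomial.C (D : ℂ) * R mu := by
  have key (s : ℕ) (hs : s < D) : P s = ∑ lam ∈ S, Polynomial.C (lam⁻¹ ^ s) * R lam := by
    refine Polynomial.eq_of_infinite_eval_eq _ _ ?_
    refine Set.Infinite.mono (s := Set.range fun q : ℕ => ((D * q + s : ℕ) : ℂ)) ?_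
      (Set.infinite_range_of_injective fun q q' hq => ?_)
    · rintro _ ⟨q, rfl⟩
      have h' := h (D * q + s)
      rw [Nat.mul_add_mod, Nat.mod_eq_of_lt hs] at h'
      rw [Set.mem_ofPred_eq, h', Polynomial.eval_finsetSum]
      refine sum_congr rfl fun lam hl => ?_
      rw [Polynomial.eval_mul, Polynomial.eval_C, pow_add, pow_mul, inv_pow lam D, hS lam hl]
      simp
    · have : D * q + s = D * q' + s := by exact_mod_cast hq
      exact Nat.eq_of_mul_eq_mul_left hD (by omega)
  have hmu0 : ∀ lam ∈ S, lam ≠ 0 := fun lam hl h0 => by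
    have := hS lam hl
    rw [h0, zero_pow hD.ne'] at this
    exact zero_ne_one this
  calc ∑ s ∈ range D, Polynomial.C (mu ^ s) * P s
      = ∑ s ∈ range D, ∑ lam ∈ S, Polynomial.C ((mu * lam⁻¹) ^ s) * R lam := by
        refine sum_congr rfl fun s hs => ?_
        rw [key s (mem_range.mp hs), mul_sum]
        refine sum_congr rfl fun lam _ => ?_
        rw [mul_pow, Polynomial.C_mul, mul_assoc]
    _ = ∑ lam ∈ S, Polynomial.C (if mu * lam⁻¹ = 1 then (D : ℂ) else 0) * R lam := by
        rw [sum_comm]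
        refine sum_congr rfl fun lam hl => ?_
        rw [← sum_mul, ← map_sum, sum_range_pow_of_pow_eq_one]
        rw [mul_pow, inv_pow, hS lam hl, hS mu hmu]; simp
    _ = _ := by
        rw [sum_eq_single_of_mem mu hmu]
        · rw [mul_inv_cancel₀ (hmu0 mu hmu), if_pos rfl]
        · intro lam hl hne
          rw [if_neg, Polynomial.C_0, zero_mul]
          intro h1
          exact hne ((mul_inv_eq_one₀ (hmu0 lam hl)).mp h1).symm

theorem sum_Icc_ite_modEq_pow {j : ℕ} (hj : 1 ≤ j) {w : ℂ} (hw : w ^ j = 1) (A : ℕ) :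
    (∑ l ∈ Icc 1 j, if A ≡ l [MOD j] then w ^ l else 0) = w ^ A := by
  have hpow {l : ℕ} (h : A ≡ l [MOD j]) : w ^ l = w ^ A := by
    rw [← Nat.mod_add_div A j, ← Nat.mod_add_div l j, pow_add, pow_add, pow_mul, pow_mul, hw,
      one_pow, one_pow, show A % j = l % j from h]
  -- Representatives run over `1, …, j`, so residue `0` is represented by `j`.
  set l₀ := if A % j = 0 then j else A % j with hl₀
  have hlt := Nat.mod_lt A hj
  have hmem : l₀ ∈ Icc 1 j := by
    rw [mem_Icc, hl₀]; split_ifs <;> omega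
  have hmod : A ≡ l₀ [MOD j] := by
    rw [hl₀, Nat.ModEq]
    split_ifs with h0
    · simp [h0]
    · simp
  rw [sum_eq_single_of_mem l₀ hmem, if_pos hmod, hpow hmod]
  intro l hl hne
  refine if_neg fun h => hne ?_
  have h1 : l % j = l₀ % j := h.symm.trans hmod
  rw [mem_Icc] at hl hmem
  rcases hl.2.eq_or_lt with h2 | h2 <;> rcases hmem.2.eq_or_lt with h3 | h3
  · omega
  · rw [h2, Nat.mod_self, Nat.mod_eq_of_lt h3] at h1; omega
  · rw [h3, Nat.mod_self, Nat.mod_eq_of_lt h2] at h1; omega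
  · rwa [Nat.mod_eq_of_lt h2, Nat.mod_eq_of_lt h3] at h1

/-! ### Binomial polynomials and power series. -/

/-- The polynomial `(X + 1) ⋯ (X + k) / k!`, with value `(n + k).choose k` at `n : ℕ`. -/
noncomputable def choosePoly (k : ℕ) : Polynomial ℂ :=
  Polynomial.C (k.factorial : ℂ)⁻¹ * (ascPochhammer ℂ k).comp (Polynomial.X + 1)

theorem X_mul_choosePoly (k : ℕ) :
    Polynomial.X * choosePoly k =
      Polynomial.C (k.factorial : ℂ)⁻¹ * ascPochhammer ℂ (k + 1) := by
  rw [choosePoly, ascPochhammer_succ_left]; ring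

theorem coeff_choosePoly (k i : ℕ) :
    (choosePoly k).coeff i = (k.factorial : ℂ)⁻¹ * (Nat.stirlingFirst (k + 1) (i + 1) : ℂ) := by
  rw [← Polynomial.coeff_X_mul, X_mul_choosePoly, Polynomial.coeff_C_mul,
    coeff_ascPochhammer_eq_stirlingFirst]

theorem natDegree_choosePoly_lt (k : ℕ) : (choosePoly k).natDegree < k + 1 := by
  rw [Nat.lt_succ_iff, Polynomial.natDegree_le_iff_coeff_eq_zero]
  intro i hi
  rw [coeff_choosePoly, Nat.stirlingFirst_eq_zero_of_lt (by omega)]; simp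

theorem eval_natCast_choosePoly (k n : ℕ) :
    (choosePoly k).eval (n : ℂ) = ((n + k).choose k : ℂ) := by
  have h : (ascPochhammer ℂ k).eval ((n : ℂ) + 1) = (k.factorial : ℂ) * ((n + k).choose k : ℂ) := by
    rw [← Nat.cast_succ, ← ascPochhammer_eval_cast, ascPochhammer_nat_eq_ascFactorial,
      Nat.succ_eq_add_one, Nat.ascFactorial_eq_factorial_mul_choose, Nat.cast_mul]
  rw [choosePoly, Polynomial.eval_mul, Polynomial.eval_C, Polynomial.eval_comp,
    Polynomial.eval_add, Polynomial.eval_X, Polynomial.eval_one, h, inv_mul_cancel_left₀]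
  exact_mod_cast k.factorial_ne_zero

/-- These zeros let the shifted polynomial give the correct coefficient `0` at indices below the
shift. -/
theorem eval_neg_natCast_choosePoly {k q : ℕ} (hq : 1 ≤ q) (hqk : q ≤ k) :
    (choosePoly k).eval (-(q : ℂ)) = 0 := by
  obtain ⟨p, rfl⟩ := Nat.exists_eq_add_of_le' hq
  rw [choosePoly, Polynomial.eval_mul, Polynomial.eval_comp,
    Polynomial.eval_add, Polynomial.eval_X, Polynomial.eval_one,
    show -((p + 1 : ℕ) : ℂ) + 1 = -(p : ℂ) by push_cast; ring,
    ascPochhammer_eval_neg_coe_nat_of_lt (by omega), mul_zero]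

theorem eq_of_hasSum_pow_eq {f g : ℕ → ℂ} {F : ℂ → ℂ}
    (hf : ∀ z : ℂ, ‖z‖ < 1 → HasSum (fun n => f n * z ^ n) (F z))
    (hg : ∀ z : ℂ, ‖z‖ < 1 → HasSum (fun n => g n * z ^ n) (F z)) : f = g := by
  have key {f : ℕ → ℂ} (hf : ∀ z : ℂ, ‖z‖ < 1 → HasSum (fun n => f n * z ^ n) (F z)) :
      HasFPowerSeriesAt F (FormalMultilinearSeries.ofScalars ℂ f) 0 := by
    rw [hasFPowerSeriesAt_iff]
    filter_upwards [Metric.ball_mem_nhds (0 : ℂ) one_pos] with z hz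
    simpa [FormalMultilinearSeries.coeff_ofScalars, mul_comm] using hf z (by simpa using hz)
  have h := (key hf).eq_formalMultilinearSeries (key hg)
  funext n
  simpa [FormalMultilinearSeries.coeff_ofScalars] using congrArg (fun p => p.coeff n) h

theorem hasSum_inv_one_sub_pow {w : ℂ} (hw : ‖w‖ < 1) (k : ℕ) :
    HasSum (fun n : ℕ => (choosePoly k).eval (n : ℂ) * w ^ n) (1 / (1 - w) ^ (k + 1)) := by
  simpa only [eval_natCast_choosePoly] using hasSum_choose_mul_geometric_of_norm_lt_one k hw

theorem hasSum_inv_sub_pow {lam z : ℂ} (hlam : ‖lam‖ = 1) (hz : ‖z‖ < 1) (k : ℕ) :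
    HasSum (fun n : ℕ => lam⁻¹ ^ n * (lam⁻¹ ^ (k + 1) * (choosePoly k).eval (n : ℂ)) * z ^ n)
      (1 / (lam - z) ^ (k + 1)) := by
  have h0 : lam ≠ 0 := by
    rintro rfl; simp at hlam
  have h := (hasSum_inv_one_sub_pow (w := lam⁻¹ * z) (by simpa [hlam] using hz) k).mul_left
    (lam⁻¹ ^ (k + 1))
  convert! h using 1
  · funext n; rw [mul_pow]; ring
  · rw [show 1 - lam⁻¹ * z = lam⁻¹ * (lam - z) by field_simp, mul_pow]
    have : lam⁻¹ ^ (k + 1) ≠ 0 := pow_ne_zero _ (inv_ne_zero h0)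
    rw [one_div, one_div, mul_inv, mul_inv_cancel_left₀ this]

/-- The polynomial `x ↦ choosePoly k ((x - A) / D)`. -/
noncomputable def shiftedChoosePoly (k D A : ℕ) : Polynomial ℂ :=
  (choosePoly k).comp (Polynomial.C (D : ℂ)⁻¹ * (Polynomial.X - Polynomial.C (A : ℂ)))

theorem eval_shiftedChoosePoly (k D A : ℕ) (x : ℂ) :
    (shiftedChoosePoly k D A).eval x = (choosePoly k).eval ((D : ℂ)⁻¹ * (x - A)) := by
  simp [shiftedChoosePoly]

theorem coeff_shiftedChoosePoly (k D A t : ℕ) :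
    (shiftedChoosePoly k D A).coeff t = 1 / (k.factorial : ℂ) * ∑ i ∈ Icc t k,
      (Nat.stirlingFirst (k + 1) (i + 1) : ℂ) * (-1 : ℂ) ^ (i - t) * (Nat.choose i t : ℂ) *
        (((D : ℂ) ^ i)⁻¹ * (A : ℂ) ^ (i - t)) := by
  rw [shiftedChoosePoly, Polynomial.comp, Polynomial.eval₂_eq_sum_range'
    _ (natDegree_choosePoly_lt k), Polynomial.finsetSum_coeff, mul_sum]
  have hs : Icc t k ⊆ range (k + 1) := fun l hl => by
    rw [mem_Icc] at hl; exact mem_range.mpr (by omega)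
  rw [← sum_subset hs]
  · refine sum_congr rfl fun i _ => ?_
    rw [mul_pow, ← Polynomial.C_pow, Polynomial.coeff_C_mul, Polynomial.coeff_C_mul,
      sub_eq_add_neg, ← Polynomial.C_neg, Polynomial.coeff_X_add_C_pow, coeff_choosePoly,
      neg_pow (A : ℂ), inv_pow]
    ring
  · intro i hi hi'
    rw [mem_range] at hi
    rw [mem_Icc] at hi'
    rw [mul_pow, ← Polynomial.C_pow, Polynomial.coeff_C_mul, Polynomial.coeff_C_mul,
      sub_eq_add_neg, ← Polynomial.C_neg, Polynomial.coeff_X_add_C_pow,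
      Nat.choose_eq_zero_of_lt (by omega)]
    simp

/-- For `n < A` in the class of `A`, the bound on `A` forces `(n - A) / D` to be one of `-1, …, -k`,
where `choosePoly k` vanishes. Hence no case distinction `n ≥ A` is needed. -/
theorem hasSum_pow_mul_inv_one_sub_pow {D k A : ℕ} (hD : 0 < D) (hA : A < (k + 1) * D) {z : ℂ}
    (hz : ‖z‖ < 1) :
    HasSum (fun n : ℕ => (if A % D = n % D then (shiftedChoosePoly k D A).eval (n : ℂ) else 0) *
      z ^ n) (z ^ A * (1 / (1 - z ^ D) ^ (k + 1))) := by
  have hD0 : (D : ℂ) ≠ 0 := by exact_mod_cast hD.ne'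
  have hinj : Function.Injective fun q : ℕ => D * q + A := fun q q' h =>
    Nat.eq_of_mul_eq_mul_left hD (by simpa using h)
  rw [← hinj.hasSum_iff]
  · have h := (hasSum_inv_one_sub_pow (w := z ^ D) (by
      rw [norm_pow]; exact pow_lt_one₀ (norm_nonneg _) hz hD.ne') k).mul_left (z ^ A)
    convert! h using 1
    funext q
    simp only [Function.comp]
    rw [if_pos (by simp), eval_shiftedChoosePoly, pow_add, pow_mul]
    rw [show (D : ℂ)⁻¹ * (((D * q + A : ℕ) : ℂ) - A) = q by push_cast; field_simp; ring]
    ring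
  · intro n hn
    split_ifs with h
    · rcases le_or_gt A n with hle | hlt
      · exfalso
        obtain ⟨q, hq⟩ := (Nat.modEq_iff_dvd' hle).mp h
        exact hn ⟨q, by simp only; omega⟩
      · obtain ⟨q, hq⟩ := (Nat.modEq_iff_dvd' hlt.le).mp h.symm
        have hA' : A = n + D * q := by omega
        have hq1 : 1 ≤ q := Nat.one_le_iff_ne_zero.mpr (by rintro rfl; omega)
        have hqk : q ≤ k := by
          by_contra hc
          have : (k + 1) * D ≤ D * q := by
            rw [mul_comm]; exact Nat.mul_le_mul_left _ (by omega)
          omega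
        rw [eval_shiftedChoosePoly, hA',
          show (D : ℂ)⁻¹ * ((n : ℂ) - ((n + D * q : ℕ) : ℂ)) = -(q : ℂ) by
            push_cast; field_simp; ring,
          eval_neg_natCast_choosePoly hq1 hqk, zero_mul]
    · rw [zero_mul]

/-! ### The two expansions of the generating function and their comparison. -/

theorem prod_inv_one_sub_pow_eq_sum {r : ℕ} {a : Fin r → ℕ} {D : ℕ} (hD : 0 < D)
    (haD : ∀ i, a i ∣ D) {z : ℂ} (hz : ‖z‖ < 1) :
    1 / ∏ i, (1 - z ^ a i) = ∑ J ∈ Fintype.piFinset fun i => range (D / a i),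
      z ^ (∑ i, a i * J i) * (1 / (1 - z ^ D) ^ r) := by
  have hne {b : ℕ} (hb : b ≠ 0) : 1 - z ^ b ≠ 0 := by
    intro h
    have : ‖z ^ b‖ < 1 := by rw [norm_pow]; exact pow_lt_one₀ (norm_nonneg _) hz hb
    rw [← sub_eq_zero.mp h, norm_one] at this
    exact lt_irrefl _ this
  have ha0 (i) : a i ≠ 0 := fun h => hD.ne' (Nat.eq_zero_of_zero_dvd (h ▸ haD i))
  rw [← sum_mul]
  have hgeom : ∑ J ∈ Fintype.piFinset fun i => range (D / a i), z ^ (∑ i, a i * J i) =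
      ∏ i, ((1 - z ^ D) / (1 - z ^ a i)) := by
    simp only [← prod_pow_eq_pow_sum, pow_mul]
    rw [← prod_univ_sum (fun i => range (D / a i)) fun i x => (z ^ a i) ^ x]
    refine prod_congr rfl fun i _ => ?_
    rw [eq_div_iff (hne (ha0 i)), geom_sum_mul_neg, ← pow_mul, Nat.mul_div_cancel' (haD i)]
  rw [hgeom, prod_div_distrib, prod_const, card_univ, Fintype.card_fin]
  have := pow_ne_zero r (hne hD.ne')
  field_simp

theorem sum_mul_lt_mul_of_mem_box {k : ℕ} {a : Fin (k + 1) → ℕ} {D : ℕ}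
    (ha : ∀ i, 0 < a i) {J : Fin (k + 1) → ℕ}
    (hJ : J ∈ Fintype.piFinset fun i => range (D / a i)) : ∑ i, a i * J i < (k + 1) * D := by
  calc ∑ i, a i * J i < ∑ _i : Fin (k + 1), D := by
        refine sum_lt_sum_of_nonempty univ_nonempty fun i _ => ?_
        have h := mem_range.mp (Fintype.mem_piFinset.mp hJ i)
        have := (Nat.lt_div_iff_mul_lt (ha i)).mp h
        rw [mul_comm]
        omega
    _ = (k + 1) * D := by simp

theorem mem_poleSet {r : ℕ} {a : Fin r → ℕ} (ha : ∀ i, 0 < a i) {lam : ℂ} :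
    lam ∈ poleSet a ↔ ∃ i, lam ^ a i = 1 := by
  simp [poleSet, Polynomial.mem_nthRootsFinset (ha _)]

theorem hasSum_partialFraction {r : ℕ} {a : Fin r → ℕ} (ha : ∀ i, 0 < a i) {c : ℂ → ℕ → ℂ}
    (hc : IsPartialFractionDecomposition a c) {z : ℂ} (hz : ‖z‖ < 1) :
    HasSum (fun n : ℕ => (∑ lam ∈ poleSet a, lam⁻¹ ^ n *
      (∑ l ∈ Icc 1 ((denomPoly a).rootMultiplicity lam),
        Polynomial.C (c lam l * lam⁻¹ ^ l) * choosePoly (l - 1)).eval (n : ℂ)) * z ^ n)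
      (1 / ∏ i, (1 - z ^ a i)) := by
  rw [hc z]
  · simp only [sum_mul, Polynomial.eval_finsetSum, mul_sum]
    refine hasSum_sum fun lam hl => hasSum_sum fun l hl' => ?_
    obtain ⟨i, hi⟩ := (mem_poleSet ha).mp hl
    obtain ⟨k, rfl⟩ := Nat.exists_eq_add_of_le' (mem_Icc.mp hl').1
    have hnorm : ‖lam‖ = 1 := Complex.norm_eq_one_of_pow_eq_one hi (ha i).ne'
    convert! (hasSum_inv_sub_pow hnorm hz k).mul_left (c lam (k + 1)) using 1
    · funext n
      rw [Polynomial.eval_mul, Polynomial.eval_C, Nat.add_sub_cancel]; ring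
    · rw [mul_one_div]
  · rw [prod_ne_zero_iff]
    intro i _ h
    have : ‖z ^ a i‖ < 1 := by
      rw [norm_pow]; exact pow_lt_one₀ (norm_nonneg _) hz (ha i).ne'
    rw [← sub_eq_zero.mp h, norm_one] at this
    exact lt_irrefl _ this

theorem partialFraction_component {k : ℕ} {a : Fin (k + 1) → ℕ} (ha : ∀ i, 0 < a i)
    {D : ℕ} (hD : 0 < D) (haD : ∀ i, a i ∣ D) {c : ℂ → ℕ → ℂ}
    (hc : IsPartialFractionDecomposition a c) {mu : ℂ} (hmu : mu ∈ poleSet a) :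
    ∑ J ∈ Fintype.piFinset fun i => range (D / a i),
        Polynomial.C (mu ^ (∑ i, a i * J i)) * shiftedChoosePoly k D (∑ i, a i * J i) =
      Polynomial.C (D : ℂ) * ∑ l ∈ Icc 1 ((denomPoly a).rootMultiplicity mu),
        Polynomial.C (c mu l * mu⁻¹ ^ l) * choosePoly (l - 1) := by
  have hS : ∀ lam ∈ poleSet a, lam ^ D = 1 := fun lam hl => by
    obtain ⟨i, hi⟩ := (mem_poleSet ha).mp hl
    obtain ⟨e, rfl⟩ := haD i
    rw [pow_mul, hi, one_pow]
  have hcoeff := eq_of_hasSum_pow_eq (F := fun z => 1 / ∏ i, (1 - z ^ a i))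
    (f := fun n => (∑ J ∈ Fintype.piFinset fun i => range (D / a i),
      if (∑ i, a i * J i) % D = n % D then shiftedChoosePoly k D (∑ i, a i * J i) else 0).eval
        (n : ℂ))
    (fun z hz => by
      rw [prod_inv_one_sub_pow_eq_sum hD haD hz]
      simp only [Polynomial.eval_finsetSum, sum_mul, apply_ite (Polynomial.eval _),
        Polynomial.eval_zero]
      exact hasSum_sum fun J hJ =>
        hasSum_pow_mul_inv_one_sub_pow hD (sum_mul_lt_mul_of_mem_box ha hJ) hz)
    (fun z hz => hasSum_partialFraction ha hc hz)
  rw [← quasiPolynomial_component hD hS (R := fun lam =>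
    ∑ l ∈ Icc 1 ((denomPoly a).rootMultiplicity lam),
      Polynomial.C (c lam l * lam⁻¹ ^ l) * choosePoly (l - 1))
    (P := fun s => ∑ J ∈ Fintype.piFinset fun i => range (D / a i),
      if (∑ i, a i * J i) % D = s then shiftedChoosePoly k D (∑ i, a i * J i) else 0)
    (fun n => congrFun hcoeff n) hmu]
  simp only [mul_sum]
  rw [sum_comm]
  refine sum_congr rfl fun J _ => ?_
  -- Each tuple contributes to a single residue class, and `mu ^ D = 1` replaces the residue in the
  -- exponent by the full sum.
  rw [sum_eq_single_of_mem _ (mem_range.mpr (Nat.mod_lt (∑ i, a i * J i) hD)), if_pos rfl]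
  · conv_lhs => rw [← Nat.mod_add_div (∑ i, a i * J i) D, pow_add, pow_mul, hS mu hmu, one_pow,
      mul_one]
    rw [Nat.mod_add_div]
  · intro s _ hs
    rw [if_neg (Ne.symm hs), mul_zero]

/-! ### Root multiplicities and existence of the decomposition. -/

theorem one_sub_X_pow_separable {n : ℕ} (hn : 0 < n) :
    (1 - Polynomial.X ^ n : Polynomial ℂ).Separable := by
  have h := Polynomial.separable_X_pow_sub_C (F := ℂ) (n := n) 1 (by exact_mod_cast hn.ne')
    one_ne_zero
  rw [← neg_sub, ← Polynomial.C_1]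
  exact h.of_dvd (neg_dvd.mpr dvd_rfl)

theorem rootMultiplicity_one_sub_X_pow {n : ℕ} (hn : 0 < n) (lam : ℂ) :
    (1 - Polynomial.X ^ n : Polynomial ℂ).rootMultiplicity lam = if lam ^ n = 1 then 1 else 0 := by
  have hne := (one_sub_X_pow_separable hn).ne_zero
  split_ifs with h
  · refine le_antisymm (Polynomial.rootMultiplicity_le_one_of_separable
      (one_sub_X_pow_separable hn) lam) ?_
    exact (Polynomial.rootMultiplicity_pos hne).mpr (by simp [h])
  · refine Polynomial.rootMultiplicity_eq_zero fun h0 => h ?_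
    have h1 : 1 - lam ^ n = 0 := by simpa using h0
    exact (sub_eq_zero.mp h1).symm

theorem denomPoly_ne_zero {r : ℕ} {a : Fin r → ℕ} (ha : ∀ i, 0 < a i) : denomPoly a ≠ 0 :=
  prod_ne_zero_iff.mpr fun i _ => (one_sub_X_pow_separable (ha i)).ne_zero

theorem rootMultiplicity_denomPoly {r : ℕ} {a : Fin r → ℕ} (ha : ∀ i, 0 < a i) (lam : ℂ) :
    (denomPoly a).rootMultiplicity lam = #{i | lam ^ a i = 1} := by
  classical
  rw [← Polynomial.count_roots, denomPoly, Polynomial.roots_prod _ _ (denomPoly_ne_zero ha),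
    Multiset.count_bind, card_filter]
  simp only [Polynomial.count_roots, rootMultiplicity_one_sub_X_pow (ha _)]
  rfl

theorem eval_denomPoly {r : ℕ} (a : Fin r → ℕ) (z : ℂ) :
    (denomPoly a).eval z = ∏ i, (1 - z ^ a i) := by
  simp [denomPoly, Polynomial.eval_prod]

theorem exists_denomPoly_eq {r : ℕ} {a : Fin r → ℕ} (ha : ∀ i, 0 < a i) :
    ∃ u : ℂ, u ≠ 0 ∧ denomPoly a = Polynomial.C u * ∏ lam ∈ poleSet a,
      (Polynomial.X - Polynomial.C lam) ^ (denomPoly a).rootMultiplicity lam := by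
  classical
  refine ⟨(denomPoly a).leadingCoeff, Polynomial.leadingCoeff_ne_zero.mpr (denomPoly_ne_zero ha),
    ?_⟩
  have hroots : (denomPoly a).roots.toFinset = poleSet a := by
    ext lam
    rw [Multiset.mem_toFinset, Polynomial.mem_roots (denomPoly_ne_zero ha), mem_poleSet ha,
      Polynomial.IsRoot, eval_denomPoly, prod_eq_zero_iff]
    simp only [mem_univ, true_and, sub_eq_zero, eq_comm (a := (1 : ℂ))]
  rw [← hroots, ← Polynomial.prod_multiset_root_eq_finset_root]
  exact (IsAlgClosed.splits _).eq_prod_roots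

/-- Partial fractions of `1 / ∏ (X - lam) ^ n lam`, with numerators multiplied out. -/
theorem exists_one_eq_sum_mul_prod_erase [DecidableEq ℂ] {S : Finset ℂ} {n : ℂ → ℕ}
    (hpos : 0 < ∑ lam ∈ S, n lam) :
    ∃ b : (lam : ℂ) → Fin (n lam) → ℂ,
      (1 : Polynomial ℂ) = ∑ lam ∈ S, ∑ j : Fin (n lam), Polynomial.C (b lam j) *
        (Polynomial.X - Polynomial.C lam) ^ j.1 *
        ∏ k ∈ S.erase lam, (Polynomial.X - Polynomial.C k) ^ n k := by
  obtain ⟨q, R, hR, hq⟩ := Polynomial.eq_quo_mul_prod_pow_add_sum_rem_mul_prod_pow (s := S)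
    (1 : Polynomial ℂ) (g := fun lam => Polynomial.X - Polynomial.C lam)
    (fun i _ => Polynomial.monic_X_sub_C i)
    (fun i _ j _ hij => Polynomial.pairwise_coprime_X_sub_C Function.injective_id hij) n
  -- Remainders modulo a linear polynomial are constants.
  have hconst : ∀ lam ∈ S, ∀ j, R lam j = Polynomial.C ((R lam j).coeff 0) := fun lam hl j => by
    refine Polynomial.eq_C_of_degree_le_zero ?_
    have h := hR lam hl j
    rw [Polynomial.degree_X_sub_C] at h
    exact (Polynomial.degree_le_iff_coeff_zero _ 0).mpr fun i hi =>
      (Polynomial.degree_lt_iff_coeff_zero _ 1).mp (by simpa using h) i (by exact_mod_cast hi)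
  have hmonic : (∏ lam ∈ S, (Polynomial.X - Polynomial.C lam) ^ n lam : Polynomial ℂ).Monic :=
    Polynomial.monic_prod_of_monic _ _ fun lam _ => (Polynomial.monic_X_sub_C lam).pow _
  have hdegP : (∏ lam ∈ S, (Polynomial.X - Polynomial.C lam) ^ n lam : Polynomial ℂ).natDegree =
      ∑ lam ∈ S, n lam := by
    rw [Polynomial.natDegree_prod_of_monic _ _
      fun lam _ => (Polynomial.monic_X_sub_C lam).pow _]
    exact sum_congr rfl fun lam _ => by
      rw [Polynomial.natDegree_pow, Polynomial.natDegree_X_sub_C, mul_one]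
  have hsum : (∑ lam ∈ S, ∑ j, R lam j * (Polynomial.X - Polynomial.C lam) ^ j.1 *
      ∏ k ∈ S.erase lam, (Polynomial.X - Polynomial.C k) ^ n k).natDegree ≤
      (∑ lam ∈ S, n lam) - 1 := by
    refine Polynomial.natDegree_sum_le_of_forall_le _ _ fun lam hl =>
      Polynomial.natDegree_sum_le_of_forall_le _ _ fun j _ => ?_
    rw [hconst lam hl j, mul_assoc]
    refine (Polynomial.natDegree_C_mul_le _ _).trans (Polynomial.natDegree_mul_le.trans ?_)
    rw [Polynomial.natDegree_pow, Polynomial.natDegree_X_sub_C, Polynomial.natDegree_prod_of_monic _ _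
      fun lam _ => (Polynomial.monic_X_sub_C lam).pow _, ← add_sum_erase S n hl]
    simp only [Polynomial.natDegree_pow, Polynomial.natDegree_X_sub_C, mul_one]
    have := j.2
    omega
  -- A nonzero quotient would make its product with the denominator have degree at least `∑ n lam`,
  -- which is positive and exceeds every other degree.
  have hq0 : q = 0 := by
    by_contra hne
    have h1 : (q * ∏ lam ∈ S, (Polynomial.X - Polynomial.C lam) ^ n lam).natDegree ≤
        (∑ lam ∈ S, n lam) - 1 := by
      rw [← sub_eq_of_eq_add hq]
      exact (Polynomial.natDegree_sub_le _ _).trans (max_le (by simp) hsum)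
    rw [Polynomial.natDegree_mul hne hmonic.ne_zero, hdegP] at h1
    omega
  refine ⟨fun lam j => (R lam j).coeff 0, ?_⟩
  rw [hq, hq0, zero_mul, zero_add]
  exact sum_congr rfl fun lam hl => sum_congr rfl fun j _ => by rw [← hconst lam hl j]

theorem exists_isPartialFractionDecomposition {r : ℕ} (hr : 1 ≤ r) {a : Fin r → ℕ}
    (ha : ∀ i, 0 < a i) : ∃ c : ℂ → ℕ → ℂ, IsPartialFractionDecomposition a c := by
  classical
  obtain ⟨u, hu, hP⟩ := exists_denomPoly_eq ha
  obtain ⟨n, hn⟩ : ∃ n : ℂ → ℕ, ∀ lam, (denomPoly a).rootMultiplicity lam = n lam :=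
    ⟨_, fun _ => rfl⟩
  simp only [hn] at hP
  have hpos : 0 < ∑ lam ∈ poleSet a, n lam := by
    have h1 : (1 : ℂ) ∈ poleSet a := (mem_poleSet ha).mpr ⟨⟨0, hr⟩, one_pow _⟩
    refine lt_of_lt_of_le ?_ (single_le_sum (f := n) (fun _ _ => Nat.zero_le _) h1)
    rw [← hn, rootMultiplicity_denomPoly ha]
    simp only [one_pow, filter_true, card_univ, Fintype.card_fin]
    omega
  obtain ⟨b, hb⟩ := exists_one_eq_sum_mul_prod_erase hpos
  -- The numerator power `(X - lam) ^ j` leaves a pole of order `l = n lam - j`; the sign turns `z -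
  -- lam` into `lam - z`. The value `0` is never used for `l` in the summation range.
  refine ⟨fun lam l => u⁻¹ * (-1) ^ l * if h : n lam - l < n lam then b lam ⟨n lam - l, h⟩ else 0,
    fun z hz => ?_⟩
  simp only [hn]
  have hPz := congrArg (Polynomial.eval z) hP
  rw [eval_denomPoly, Polynomial.eval_mul, Polynomial.eval_C, Polynomial.eval_prod] at hPz
  simp only [Polynomial.eval_pow, Polynomial.eval_sub, Polynomial.eval_X, Polynomial.eval_C]
    at hPz
  have hprod : ∏ lam ∈ poleSet a, (z - lam) ^ n lam ≠ 0 := fun h => by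
    rw [hPz] at hz; exact hz (by rw [h, mul_zero])
  have hbz := congrArg (Polynomial.eval z) hb
  simp only [Polynomial.eval_finsetSum, Polynomial.eval_mul, Polynomial.eval_pow,
    Polynomial.eval_sub, Polynomial.eval_X, Polynomial.eval_C, Polynomial.eval_one,
    Polynomial.eval_prod] at hbz
  rw [hPz, one_div, mul_inv, ← one_mul (∏ lam ∈ poleSet a, (z - lam) ^ n lam)⁻¹]
  conv_lhs => rw [hbz]
  rw [sum_mul, mul_sum]
  refine sum_congr rfl fun lam hl => ?_
  rw [sum_mul, mul_sum]
  have hpow : (z - lam) ^ n lam ≠ 0 := prod_ne_zero_iff.mp hprod lam hl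
  have herase : ∏ k ∈ (poleSet a).erase lam, (z - k) ^ n k ≠ 0 :=
    prod_ne_zero_iff.mpr fun k hk => prod_ne_zero_iff.mp hprod k (mem_of_mem_erase hk)
  refine sum_bij (fun j _ => n lam - j.1) ?_ ?_ ?_ ?_
  · intro j _
    have := j.2
    exact mem_Icc.mpr ⟨by omega, by omega⟩
  · intro j _ j' _ h
    have := j.2
    have := j'.2
    exact Fin.ext (by omega)
  · intro l hl'
    have := mem_Icc.mp hl'
    exact ⟨⟨n lam - l, by omega⟩, mem_univ _, by simp only; omega⟩
  · intro j _
    have hj := j.2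
    have hidx : n lam - (n lam - j.1) = j.1 := by omega
    have hz0 : z - lam ≠ 0 := fun h => hpow (by rw [h, zero_pow (by omega)])
    rw [dif_pos (show n lam - (n lam - j.1) < n lam by omega)]
    simp only [hidx]
    rw [← mul_prod_erase _ _ hl, ← neg_sub z lam, neg_pow (z - lam)]
    have hsplit : (z - lam) ^ n lam = (z - lam) ^ j.1 * (z - lam) ^ (n lam - j.1) := by
      rw [← pow_add]; congr 1; omega
    rw [hsplit]
    have h1 : ((-1 : ℂ)) ^ (n lam - j.1) ≠ 0 := pow_ne_zero _ (by norm_num)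
    have h2 := pow_ne_zero j.1 hz0
    have h3 := pow_ne_zero (n lam - j.1) hz0
    field_simp

/-! ### Extraction of the coefficients at `rootOfUnity j`. -/

theorem rootOfUnity_isPrimitiveRoot {j : ℕ} (hj : 1 ≤ j) : IsPrimitiveRoot (rootOfUnity j) j :=
  Complex.isPrimitiveRoot_exp j (by omega)

theorem rootMultiplicity_denomPoly_rootOfUnity {r : ℕ} {a : Fin r → ℕ} (ha : ∀ i, 0 < a i)
    {j : ℕ} (hj : 1 ≤ j) : (denomPoly a).rootMultiplicity (rootOfUnity j) = multCount a j := by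
  rw [rootMultiplicity_denomPoly ha, multCount]
  simp only [(rootOfUnity_isPrimitiveRoot hj).pow_eq_one_iff_dvd]

theorem partialFraction_coefficient {k : ℕ} {a : Fin (k + 1) → ℕ} (ha : ∀ i, 0 < a i)
    {D : ℕ} (hD : 0 < D) (haD : ∀ i, a i ∣ D) {c : ℂ → ℕ → ℂ}
    (hc : IsPartialFractionDecomposition a c) {mu : ℂ} (hmu : mu ∈ poleSet a) {m : ℕ}
    (hm : 1 ≤ m) (hmM : m ≤ (denomPoly a).rootMultiplicity mu) :
    c mu m = mu ^ m * (Nat.factorial (m - 1) : ℂ) / (D : ℂ) *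
      ∑ t ∈ Icc m ((denomPoly a).rootMultiplicity mu),
        (-1 : ℂ) ^ (t - m) * (Nat.stirlingSecond t m : ℂ) *
          ∑ J ∈ Fintype.piFinset fun i => range (D / a i),
            mu ^ (∑ i, a i * J i) * (shiftedChoosePoly k D (∑ i, a i * J i)).coeff (t - 1) := by
  have hD0 : (D : ℂ) ≠ 0 := by exact_mod_cast hD.ne'
  have hmu0 : mu ≠ 0 := by
    rintro rfl
    obtain ⟨i, hi⟩ := (mem_poleSet ha).mp hmu
    rw [zero_pow (ha i).ne'] at hi
    exact zero_ne_one hi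
  have hcomp := partialFraction_component ha hD haD hc hmu
  set M := (denomPoly a).rootMultiplicity mu
  -- Multiplying by `X` turns each `choosePoly (l - 1)` into a rising factorial over `(l - 1)!`, the
  -- source of `(m - 1)!` in the formula.
  have hX : Polynomial.X * (∑ J ∈ Fintype.piFinset fun i => range (D / a i),
        Polynomial.C (mu ^ (∑ i, a i * J i)) * shiftedChoosePoly k D (∑ i, a i * J i)) =
      ∑ l ∈ Icc 1 M, Polynomial.C ((D : ℂ) * (c mu l * mu⁻¹ ^ l) *
        ((l - 1).factorial : ℂ)⁻¹) * ascPochhammer ℂ l := by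
    rw [hcomp, mul_sum, mul_sum]
    refine sum_congr rfl fun l hl => ?_
    obtain ⟨p, rfl⟩ := Nat.exists_eq_add_of_le' (mem_Icc.mp hl).1
    rw [Nat.add_sub_cancel, Polynomial.C_mul (b := (p.factorial : ℂ)⁻¹),
      Polynomial.C_mul (a := (D : ℂ)), mul_assoc _ (Polynomial.C (p.factorial : ℂ)⁻¹), ← X_mul_choosePoly]
    ring
  have h := coeff_eq_sum_stirlingSecond hX hm hmM
  simp only [Polynomial.finsetSum_coeff, Polynomial.coeff_C_mul] at h
  rw [← h]
  have hf : ((m - 1).factorial : ℂ) ≠ 0 := by exact_mod_cast (m - 1).factorial_ne_zero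
  have hp := pow_ne_zero m hmu0
  rw [inv_pow]
  field_simp

/-- Each tuple lies in exactly one residue class, and `w ^ l` depends only on `l` modulo `j`. -/
theorem sum_boxTuples_eq {r : ℕ} {a : Fin r → ℕ} {D j : ℕ} (hj : 1 ≤ j) {w : ℂ} (hw : w ^ j = 1)
    (s : Finset ℕ) (K : ℕ → ℂ) (H : ℕ → (Fin r → ℕ) → ℂ) :
    ∑ l ∈ Icc 1 j, w ^ l * ∑ k ∈ s, K k * ∑ J ∈ boxTuples a D j l, H k J =
      ∑ J ∈ Fintype.piFinset fun i => range (D / a i),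
        w ^ (∑ i, a i * J i) * ∑ k ∈ s, K k * H k J := by
  have h1 (l : ℕ) : ∑ k ∈ s, K k * ∑ J ∈ boxTuples a D j l, H k J =
      ∑ J ∈ Fintype.piFinset fun i => range (D / a i),
        if (∑ i, a i * J i) ≡ l [MOD j] then ∑ k ∈ s, K k * H k J else 0 := by
    rw [← sum_filter, sum_comm]
    simp only [boxTuples, mul_sum]
  simp only [h1]
  simp only [mul_sum (Fintype.piFinset _)]
  rw [sum_comm]
  refine sum_congr rfl fun J _ => ?_
  rw [← sum_Icc_ite_modEq_pow hj hw (∑ i, a i * J i), sum_mul]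
  refine sum_congr rfl fun l _ => ?_
  rw [mul_ite, ite_mul, mul_zero, zero_mul]

theorem proposition4p4 (r : ℕ) (hr : 1 ≤ r) (a : Fin r → ℕ) (ha : ∀ i, 0 < a i)
    (D : ℕ) (hD : 0 < D) (haD : ∀ i, a i ∣ D) :
    (∃ c : ℂ → ℕ → ℂ, IsPartialFractionDecomposition a c) ∧
    ∀ c : ℂ → ℕ → ℂ, IsPartialFractionDecomposition a c →
      ∀ j : ℕ, 1 ≤ j → ∀ m : ℕ, 1 ≤ m → m ≤ multCount a j →
        c (rootOfUnity j) m =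
          rootOfUnity j ^ m * (Nat.factorial (m - 1) : ℂ) / (D : ℂ) *
            ∑ t ∈ Icc m (multCount a j),
              (-1 : ℂ) ^ (t - m) * (Nat.stirlingSecond t m : ℂ) *
                (1 / (Nat.factorial (r - 1) : ℂ) *
                  ∑ l ∈ Icc 1 j, rootOfUnity j ^ l *
                    ∑ k ∈ Icc (t - 1) (r - 1),
                      (Nat.stirlingFirst r (k + 1) : ℂ) * (-1 : ℂ) ^ (k - (t - 1)) *
                        (Nat.choose k (t - 1) : ℂ) *
                        ∑ J ∈ boxTuples a D j l,
                          ((D : ℂ) ^ k)⁻¹ *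
                            ((∑ i, a i * J i : ℕ) : ℂ) ^ (k - (t - 1))) := by
  refine ⟨exists_isPartialFractionDecomposition hr ha, fun c hc j hj m hm hmM => ?_⟩
  obtain ⟨k, rfl⟩ := Nat.exists_eq_add_of_le' hr
  have hmult := rootMultiplicity_denomPoly_rootOfUnity ha hj
  have hprim := rootOfUnity_isPrimitiveRoot hj
  have hmu : rootOfUnity j ∈ poleSet a := by
    obtain ⟨i, hi⟩ := card_pos.mp (lt_of_lt_of_le hm hmM)
    exact (mem_poleSet ha).mpr ⟨i, (hprim.pow_eq_one_iff_dvd _).mpr (mem_filter.mp hi).2⟩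
  rw [partialFraction_coefficient ha hD haD hc hmu hm (hmult ▸ hmM), hmult]
  congr 1
  refine sum_congr rfl fun t _ => ?_
  congr 1
  rw [sum_boxTuples_eq hj hprim.pow_eq_one, mul_sum]
  refine sum_congr rfl fun J _ => ?_
  rw [coeff_shiftedChoosePoly, Nat.add_sub_cancel]
  ring
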